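/- Let $\mathcal X$ be a real separable Hilbert space and let $k\colon\mathcal X\times\mathcal X\to\mathbb R$ be a kernel (symmetric, and such that every matrix $(k(u_i,u_j))_{i,j}$ is positive semi-definite) with reproducing kernel Hilbert space $\mathcal H_k$. Assume that for some $L>0$ $$|k(x,y)-k(u,v)|\le L\,\|x-y-(u-v)\|_{\mathcal X}\qquad\text{for all }x,y,u,v\in\mathcal X .$$ Let $P\ne Q$ be Borel probability measures on $\mathcal X$, and let $x_1,x_2,\dots$ and $y_1,y_2,\dots$ be mutually independent random elements of $\mathcal X$ with $x_i\sim P$ and $y_i\sim Q$. For each $n$ let $\mathcal I_n\colon\mathcal X\to\mathbb R^{N(n)}$ (discretisation) and $\mathcal R_n\colon\mathbb R^{N(n)}\to\mathcal X$ (reconstruction) be maps, with $N(n)\to\infty$ as $n\to\infty$, such that $\mathcal R_n\mathcal I_n$ is measurable up to $P$-null sets and up to $Q$-null sets. Write $$\mathrm{MMD}_k(P,Q)=\sup_{\|f\|_{\mathcal H_k}\le 1}\Big|\int f\,dP-\int f\,dQ\Big| ,$$ $h(z,z')=k(x,x')+k(y,y')-k(x,y')-k(x',y)$ for $z=(x,y)$,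 $z'=(x',y')$, and, for samples $A=(a_i)_{i=1}^n$ and $B=(b_i)_{i=1}^n$ in $\mathcal X$, $$\widehat{\mathrm{MMD}}_k(A,B)^2=\frac1{n(n-1)}\sum_{i\ne j}h\big((a_i,b_i),(a_j,b_j)\big).$$ If $$n^{1/2}\,\mathbb E_{x\sim P}\|x-\mathcal R_n\mathcal I_nx\|_{\mathcal X}\to0\quad\text{and}\quad n^{1/2}\,\mathbb E_{y\sim Q}\|y-\mathcal R_n\mathcal I_ny\|_{\mathcal X}\to0\qquad(n\to\infty),$$ then, with $\xi=4\,\mathrm{Var}_{z}\big[\mathbb E_{z'}[h(z,z')]\big]$ where $z,z'$ are independent with law $P\otimes Q$, $$n^{1/2}\Big(\widehat{\mathrm{MMD}}_k\big((\mathcal R_n\mathcal I_nx_i)_{i=1}^n,(\mathcal R_n\mathcal I_ny_i)_{i=1}^n\big)^2-\mathrm{MMD}_k(P,Q)^2\Big)\xrightarrow{d}\mathcal N(0,\xi)\qquad(n\to\infty),$$ where $\mathcal N(0,0)$ denotes the Dirac mass at $0$. -/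

import Mathlib

open MeasureTheory ProbabilityTheory Filter Topology

noncomputable section

/-- A (real-valued, symmetric, positive definite) kernel on `X`: every matrix
`(k (x i) (x j))` is positive semi-definite. -/
structure PDKernel (X : Type*) where
  toFun : X → X → ℝ
  symm : ∀ x y, toFun x y = toFun y x
  posSemidef : ∀ (N : ℕ) (x : Fin N → X),
    (Matrix.of fun i j => toFun (x i) (x j)).PosSemidef

namespace PDKernel

variable {X : Type*}

instance : CoeFun (PDKernel X) (fun _ => X → X → ℝ) := ⟨PDKernel.toFun⟩

/-- The kernel as an operator-valued matrix, the real number `k x y` acting on `ℝ` by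
multiplication; this is the form in which Mathlib builds the RKHS of a kernel. -/
def opMatrix (k : PDKernel X) : Matrix X X (ℝ →L[ℝ] ℝ) :=
  Matrix.of fun x y => k x y • ContinuousLinearMap.id ℝ ℝ

theorem opMatrix_posSemidef (k : PDKernel X) : k.opMatrix.PosSemidef := by
  have tf := RKHS.posSemidef_tfae (K := k.opMatrix)
  refine (tf.out 0 2 :
    k.opMatrix.PosSemidef ↔ k.opMatrix.IsHermitian ∧ ∀ (vv : X →₀ ℝ),
      0 ≤ RCLike.re (vv.sum fun x w ↦ vv.sum fun x' w' ↦ inner ℝ (k.opMatrix x' x w) w')).mpr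
    ⟨?_, fun vv => ?_⟩
  · ext x y
    have h1 : star (ContinuousLinearMap.id ℝ ℝ) = ContinuousLinearMap.id ℝ ℝ :=
      star_one (ℝ →L[ℝ] ℝ)
    simp [opMatrix, k.symm x y, Matrix.conjTranspose_apply, star_smul, h1]
  · have h := k.posSemidef vv.support.card (fun i => (vv.support.equivFin.symm i : X))
    have h2 := h.dotProduct_mulVec_nonneg (fun i => vv (vv.support.equivFin.symm i : X))
    simp only [dotProduct, Matrix.mulVec, Matrix.of_apply, Pi.star_apply, star_trivial,
      Finset.mul_sum] at h2
    have e : ∀ g : X → ℝ, ∑ i, g (vv.support.equivFin.symm i : X) = ∑ x ∈ vv.support, g x := by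
      intro g
      rw [Equiv.sum_comp vv.support.equivFin.symm (fun x : vv.support => g x)]
      exact Finset.sum_coe_sort vv.support g
    rw [e (fun x => ∑ j, vv x * (k x (vv.support.equivFin.symm j : X)
      * vv (vv.support.equivFin.symm j : X)))] at h2
    simp only [fun x => e (fun y => vv x * (k x y * vv y))] at h2
    refine h2.trans_eq ?_
    simp only [Finsupp.sum, opMatrix, Matrix.of_apply, RCLike.re_to_real]
    refine Finset.sum_congr rfl fun x _ => Finset.sum_congr rfl fun y _ => ?_
    simp [k.symm x y]
    ring

instance (k : PDKernel X) : Fact k.opMatrix.PosSemidef := ⟨k.opMatrix_posSemidef⟩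

/-- The reproducing kernel Hilbert space of `k`; its elements are functions `X → ℝ`. -/
abbrev rkhs (k : PDKernel X) : Type _ := RKHS.OfKernel k.opMatrix

/-- The maximum mean discrepancy: the supremum of `|∫ f dP - ∫ f dQ|` over the unit ball of the
reproducing kernel Hilbert space of `k`. -/
def mmd (k : PDKernel X) [MeasurableSpace X] (P Q : Measure X) : ℝ :=
  sSup {r : ℝ | ∃ f : k.rkhs, ‖f‖ ≤ 1 ∧ r = |∫ x, f x ∂P - ∫ x, f x ∂Q|}

/-- `h(z, z') = k(x, x') + k(y, y') - k(x, y') - k(x', y)` for `z = (x, y)`, `z' = (x', y')`. -/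
def h (k : PDKernel X) (z z' : X × X) : ℝ :=
  k z.1 z'.1 + k z.2 z'.2 - k z.1 z'.2 - k z'.1 z.2

/-- The U-statistic estimating the squared maximum mean discrepancy from two samples of
size `n`. -/
def mmdSqU (k : PDKernel X) {n : ℕ} (x y : Fin n → X) : ℝ :=
  (1 / ((n : ℝ) * ((n : ℝ) - 1))) *
    ∑ i, ∑ j with i ≠ j, k.h (x i, y i) (x j, y j)

end PDKernel

end

/-!
The kernel is an inner product of features, `k x y = ⟪φ x, φ y⟫` with `φ x = k(·, x)` in the
reproducing kernel Hilbert space, so `h z z' = ⟪ψ z, ψ z'⟫` for `ψ (x, y) = φ x - φ y`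
(`PDKernel.inner_featureDiff`), and the maximum mean discrepancy is the norm of `m = 𝔼 ψ`
(`PDKernel.mmd_eq_norm_integral_featureDiff`). The Lipschitz condition makes `k` constant on the
diagonal, hence `ψ` bounded, and makes `φ` continuous; no moment condition is needed.

For the undiscretised sample, the Hoeffding decomposition (`innerUStat_decomposition`) writes the
U-statistic minus `‖m‖²` as `2 / n * ∑ (⟪ψ (z i), m⟫ - ‖m‖²)` plus
`(‖∑ W i‖² - ∑ ‖W i‖²) / (n (n - 1))` with `W i = ψ (z i) - m`. The first part is governed by the
central limit theorem, with variance `4 Var ⟪ψ, m⟫ = 4 Var 𝔼 h(z, ·)`. The `W i` are centred and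
independent, thus orthogonal in `L²`, so both terms of the second part have the same expectation,
of order `1 / n` (`lintegral_norm_sum_sq_sub_le`); it vanishes in `L¹` at the scale `√n`. This is
`tendstoInDistribution_innerUStat`.

Discretising the sample changes the U-statistic by at most `4 L` times the mean displacement
(`PDKernel.abs_mmdSqU_sub_le`), and `√n` times this tends to `0` in `L¹` by hypothesis. A Slutsky
argument concludes.
-/

/-! ### Independence of paired families -/

theorem ProbabilityTheory.iIndepFun.prodMk_of_measurable {ι Ω α : Type*} [MeasurableSpace Ω] [MeasurableSpace α]
    {μ : Measure Ω} {x y : ι → Ω → α} (hx : ∀ i, Measurable (x i)) (hy : ∀ i, Measurable (y i))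
    (h : iIndepFun (Sum.elim x y) μ) : iIndepFun (fun i ω => (x i ω, y i ω)) μ := by
  -- the joint law of `x` and `y` on rectangles indexed by a finite set of pairs
  have key : ∀ (s : Finset ι) (A B : ι → Set α), (∀ i ∈ s, MeasurableSet (A i)) →
      (∀ i ∈ s, MeasurableSet (B i)) →
      μ (⋂ i ∈ s, x i ⁻¹' A i ∩ y i ⁻¹' B i)
        = (∏ i ∈ s, μ (x i ⁻¹' A i)) * ∏ i ∈ s, μ (y i ⁻¹' B i) := by
    intro s A B hA hB
    have := h.measure_inter_preimage_eq_mul (s.disjSum s) (sets := Sum.elim A B) (by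
      intro i hi
      rcases i with i | i
      · exact hA i (by simpa using hi)
      · exact hB i (by simpa using hi))
    rw [Finset.prod_disjSum] at this
    simp only [Sum.elim_inl, Sum.elim_inr] at this
    rw [← this]
    congr 1
    ext ω
    simp only [Set.mem_iInter, Set.mem_inter_iff, Finset.mem_disjSum]
    constructor
    · rintro H j (⟨i, hi, rfl⟩ | ⟨i, hi, rfl⟩)
      · exact (H i hi).1
      · exact (H i hi).2
    · exact fun H i hi => ⟨H (.inl i) (.inl ⟨i, hi, rfl⟩), H (.inr i) (.inr ⟨i, hi, rfl⟩)⟩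
  rw [iIndepFun_iff_iIndep]
  refine iIndepSets.iIndep (fun i => ((hx i).prodMk (hy i)).comap_le)
    (fun i => Set.preimage (fun ω => (x i ω, y i ω)) '' Set.image2 (· ×ˢ ·)
      {s : Set α | MeasurableSet s} {t : Set α | MeasurableSet t})
    (fun i => by
      rintro _ ⟨s, hs, rfl⟩ _ ⟨t, ht, rfl⟩ hst
      rw [← Set.preimage_inter] at hst ⊢
      exact ⟨_, isPiSystem_prod s hs t ht (Set.nonempty_of_nonempty_preimage hst), rfl⟩)
    (fun i => by rw [← generateFrom_prod, MeasurableSpace.comap_generateFrom]) ?_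
  rw [iIndepSets_iff]
  intro s f hf
  have hf' : ∀ i, i ∈ s → ∃ A B : Set α, MeasurableSet A ∧ MeasurableSet B ∧
      f i = x i ⁻¹' A ∩ y i ⁻¹' B := by
    intro i hi
    obtain ⟨_, ⟨A, hA, B, hB, rfl⟩, hAB⟩ := hf i hi
    exact ⟨A, B, hA, hB, by rw [← hAB]; rfl⟩
  choose! A B hA hB hAB using hf'
  have e1 : ∀ i ∈ s, μ (f i) = μ (x i ⁻¹' A i) * μ (y i ⁻¹' B i) := by
    intro i hi
    have := key {i} A B (by simpa using hA i hi) (by simpa using hB i hi)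
    simpa [hAB i hi] using this
  rw [Finset.prod_congr rfl e1, Finset.prod_mul_distrib, ← key s A B hA hB]
  congr 1
  exact Set.iInter₂_congr hAB

/-- If the members of two families of random variables are jointly independent, the pairs formed
from equal indices are independent. -/
theorem ProbabilityTheory.iIndepFun.prodMk_of_sumElim {ι Ω α : Type*} [MeasurableSpace Ω] [MeasurableSpace α]
    {μ : Measure Ω} {x y : ι → Ω → α} (hx : ∀ i, AEMeasurable (x i) μ)
    (hy : ∀ i, AEMeasurable (y i) μ)
    (h : iIndepFun (Sum.elim x y) μ) : iIndepFun (fun i ω => (x i ω, y i ω)) μ := by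
  have h' : iIndepFun (Sum.elim (fun i => (hx i).mk) (fun i => (hy i).mk)) μ :=
    h.congr (by rintro (i | i); exacts [(hx i).ae_eq_mk, (hy i).ae_eq_mk])
  refine (iIndepFun.prodMk_of_measurable (fun i => (hx i).measurable_mk)
    (fun i => (hy i).measurable_mk) h').congr fun i => ?_
  filter_upwards [(hx i).ae_eq_mk, (hy i).ae_eq_mk] with ω h1 h2
  rw [← h1, ← h2]

/-! ### U-statistics with an inner product kernel -/

noncomputable section
open scoped RealInnerProductSpace

/-- The U-statistic of order two with kernel the inner product: the average of `⟪v i, v j⟫` over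
the ordered pairs `i ≠ j`. It is `0` for samples of size at most one. -/
def innerUStat {H : Type*} [NormedAddCommGroup H] [InnerProductSpace ℝ H] {n : ℕ}
    (v : Fin n → H) : ℝ :=
  (1 / ((n : ℝ) * ((n : ℝ) - 1))) * ∑ i, ∑ j with i ≠ j, ⟪v i, v j⟫

variable {H : Type*} [NormedAddCommGroup H] [InnerProductSpace ℝ H]

theorem sum_offDiag_inner {n : ℕ} (v : Fin n → H) :
    ∑ i, ∑ j with i ≠ j, ⟪v i, v j⟫ = ‖∑ i, v i‖ ^ 2 - ∑ i, ‖v i‖ ^ 2 := by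
  have : ∀ i, ∑ j with i ≠ j, ⟪v i, v j⟫ = ∑ j, ⟪v i, v j⟫ - ‖v i‖ ^ 2 := by
    intro i
    rw [Finset.filter_ne, Finset.sum_erase_eq_sub (Finset.mem_univ i), real_inner_self_eq_norm_sq]
  rw [Finset.sum_congr rfl fun i _ => this i, Finset.sum_sub_distrib,
    ← real_inner_self_eq_norm_sq, sum_inner]
  simp only [inner_sum]

/-- The Hoeffding decomposition of `innerUStat` about the point `m`. -/
theorem innerUStat_decomposition {n : ℕ} (hn : 2 ≤ n) (v : Fin n → H) (m : H) :
    innerUStat v - ‖m‖ ^ 2 = 2 / n * (∑ i, ⟪v i, m⟫ - n * ‖m‖ ^ 2)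
      + (1 / ((n : ℝ) * ((n : ℝ) - 1))) *
        (‖∑ i, (v i - m)‖ ^ 2 - ∑ i, ‖v i - m‖ ^ 2) := by
  have hn' : (2 : ℝ) ≤ n := by exact_mod_cast hn
  have h1 : (n : ℝ) ≠ 0 := by positivity
  have h2 : (n : ℝ) - 1 ≠ 0 := by linarith
  have e1 : ‖∑ i, (v i - m)‖ ^ 2
      = ‖∑ i, v i‖ ^ 2 - 2 * n * ∑ i, ⟪v i, m⟫ + n ^ 2 * ‖m‖ ^ 2 := by
    rw [Finset.sum_sub_distrib, norm_sub_sq_real, Finset.sum_const, Finset.card_univ,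
      Fintype.card_fin, ← Nat.cast_smul_eq_nsmul ℝ, inner_smul_right, norm_smul, sum_inner,
      Real.norm_natCast]
    ring
  have e2 : ∑ i, ‖v i - m‖ ^ 2
      = ∑ i, ‖v i‖ ^ 2 - 2 * ∑ i, ⟪v i, m⟫ + n * ‖m‖ ^ 2 := by
    simp only [norm_sub_sq_real, Finset.sum_add_distrib, Finset.sum_sub_distrib, Finset.mul_sum]
    simp
  rw [innerUStat, sum_offDiag_inner, e1, e2]
  field_simp
  ring

variable {Ω : Type*} [MeasurableSpace Ω] {μ : Measure Ω}

theorem aemeasurable_innerUStat {n : ℕ} {v : Fin n → Ω → H}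
    (hv : ∀ i, AEStronglyMeasurable (v i) μ) :
    AEMeasurable (fun ω => innerUStat fun i => v i ω) μ := by
  unfold innerUStat
  refine AEMeasurable.const_mul ?_ _
  refine Finset.aemeasurable_fun_sum _ fun i _ => Finset.aemeasurable_fun_sum _ fun j _ => ?_
  exact ((hv i).inner (hv j)).aemeasurable

/-- For bounded pairwise orthogonal random vectors the degenerate part of the U-statistic is of
order `n` in `L¹`: its two terms have the same expectation. -/
theorem lintegral_norm_sum_sq_sub_le [IsProbabilityMeasure μ] {n : ℕ} {v : Fin n → Ω → H} {C : ℝ}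
    (hv : ∀ i, AEStronglyMeasurable (v i) μ) (hC : ∀ i ω, ‖v i ω‖ ≤ C)
    (horth : ∀ i j, i ≠ j → ∫ ω, ⟪v i ω, v j ω⟫ ∂μ = 0) :
    ∫⁻ ω, ‖‖∑ i, v i ω‖ ^ 2 - ∑ i, ‖v i ω‖ ^ 2‖ₑ ∂μ ≤ ENNReal.ofReal (2 * n * C ^ 2) := by
  have hint : ∀ i j, Integrable (fun ω => ⟪v i ω, v j ω⟫) μ := fun i j =>
    Integrable.of_bound ((hv i).inner (hv j)) (C * C) (ae_of_all _ fun ω =>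
      (norm_inner_le_norm _ _).trans (mul_le_mul (hC i ω) (hC j ω) (norm_nonneg _)
        ((norm_nonneg _).trans (hC i ω))))
  have hsq : ∀ i, Integrable (fun ω => ‖v i ω‖ ^ 2) μ := fun i => by
    simpa only [real_inner_self_eq_norm_sq] using hint i i
  have hexp : ∀ ω, ‖∑ i, v i ω‖ ^ 2 = ∑ i, ∑ j, ⟪v i ω, v j ω⟫ := fun ω => by
    rw [← real_inner_self_eq_norm_sq, sum_inner]; simp only [inner_sum]
  have hS : Integrable (fun ω => ‖∑ i, v i ω‖ ^ 2) μ := by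
    simp only [hexp]
    exact integrable_finsetSum _ fun i _ => integrable_finsetSum _ fun j _ => hint i j
  have hD : Integrable (fun ω => ∑ i, ‖v i ω‖ ^ 2) μ := integrable_finsetSum _ fun i _ => hsq i
  have hSD : ∫ ω, ‖∑ i, v i ω‖ ^ 2 ∂μ = ∫ ω, ∑ i, ‖v i ω‖ ^ 2 ∂μ := by
    simp only [hexp]
    rw [integral_finsetSum _ fun i _ => integrable_finsetSum _ fun j _ => hint i j,
      integral_finsetSum _ fun i _ => hsq i]
    refine Finset.sum_congr rfl fun i _ => ?_
    rw [integral_finsetSum _ fun j _ => hint i j, Finset.sum_eq_single i]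
    · simp only [real_inner_self_eq_norm_sq]
    · exact fun j _ hj => horth i j hj.symm
    · simp
  have hDle : ∫ ω, ∑ i, ‖v i ω‖ ^ 2 ∂μ ≤ n * C ^ 2 := by
    have : ∀ ω, ∑ i, ‖v i ω‖ ^ 2 ≤ n * C ^ 2 := fun ω => by
      refine (Finset.sum_le_sum fun i _ => pow_le_pow_left₀ (norm_nonneg _) (hC i ω) 2).trans ?_
      simp
    simpa using integral_mono hD (integrable_const (n * C ^ 2)) this
  refine (ofReal_integral_norm_eq_lintegral_enorm (hS.sub hD)).symm.trans_le ?_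
  refine ENNReal.ofReal_le_ofReal ?_
  calc ∫ ω, ‖‖∑ i, v i ω‖ ^ 2 - ∑ i, ‖v i ω‖ ^ 2‖ ∂μ
      ≤ ∫ ω, (‖∑ i, v i ω‖ ^ 2 + ∑ i, ‖v i ω‖ ^ 2) ∂μ := by
        refine integral_mono (hS.sub hD).norm (hS.add hD) fun ω => ?_
        refine (norm_sub_le _ _).trans_eq ?_
        rw [Real.norm_of_nonneg (by positivity), Real.norm_of_nonneg (by positivity)]
    _ ≤ 2 * n * C ^ 2 := by rw [integral_add hS hD, hSD]; linarith

theorem tendstoInMeasure_zero_of_tendsto_lintegral_enorm {D : ℕ → Ω → ℝ}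
    (hD : ∀ n, AEStronglyMeasurable (D n) μ)
    (h : Tendsto (fun n => ∫⁻ ω, ‖D n ω‖ₑ ∂μ) atTop (𝓝 0)) : TendstoInMeasure μ D atTop 0 := by
  refine tendstoInMeasure_of_tendsto_eLpNorm one_ne_zero hD aestronglyMeasurable_zero ?_
  simpa only [sub_zero, eLpNorm_one_eq_lintegral_enorm] using h

variable {Z : Type*} [MeasurableSpace Z]

/-- Central limit theorem for the U-statistic `innerUStat` of a bounded Hilbert space valued
feature `ψ` of an i.i.d. sample. -/
theorem tendstoInDistribution_innerUStat [CompleteSpace H] [IsProbabilityMeasure μ]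
    {ν : Measure Z} [IsProbabilityMeasure ν] {z : ℕ → Ω → Z} (hz : ∀ i, HasLaw (z i) ν μ)
    (hind : iIndepFun z μ) {ψ : Z → H} (hψ : StronglyMeasurable ψ) {C : ℝ}
    (hC : ∀ u, ‖ψ u‖ ≤ C) :
    TendstoInDistribution
      (fun (n : ℕ) ω => √(n : ℝ) * (innerUStat (fun i : Fin n => ψ (z i ω))
        - ‖∫ u, ψ u ∂ν‖ ^ 2))
      atTop (id : ℝ → ℝ) (fun _ => μ)
      (gaussianReal 0 (4 * Var[fun u => ⟪ψ u, ∫ u', ψ u' ∂ν⟫; ν]).toNNReal) := by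
  set m := ∫ u, ψ u ∂ν with hm
  have hψi : Integrable ψ ν := Integrable.of_bound hψ.aestronglyMeasurable C (ae_of_all _ hC)
  have hψz : ∀ i, AEStronglyMeasurable (fun ω => ψ (z i ω)) μ := fun i =>
    hψ.aestronglyMeasurable.comp_aemeasurable (hz i).aemeasurable
  -- the linear part of the Hoeffding decomposition
  set g : Z → ℝ := fun u => 2 * ⟪ψ u, m⟫ with hg
  have hgm : Measurable g := (hψ.inner stronglyMeasurable_const).measurable.const_mul 2
  have hgint : μ[g ∘ z 0] = 2 * ‖m‖ ^ 2 := by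
    rw [(hz 0).integral_comp hgm.aestronglyMeasurable, integral_const_mul,
      ← real_inner_self_eq_norm_sq]
    congr 1
    simp only [real_inner_comm m]
    exact integral_inner hψi m
  have hvar : Var[g ∘ z 0; μ] = 4 * Var[fun u => ⟪ψ u, m⟫; ν] := by
    rw [← variance_map hgm.aemeasurable (hz 0).aemeasurable, (hz 0).map_eq, hg,
      variance_const_mul]
    norm_num
  have hid : ∀ i, IdentDistrib (g ∘ z i) (g ∘ z 0) μ μ := fun i =>
    (IdentDistrib.mk (hz i).aemeasurable (hz 0).aemeasurable
      ((hz i).map_eq.trans (hz 0).map_eq.symm)).comp hgm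
  have hmem : MemLp (g ∘ z 0) 2 μ := by
    refine MemLp.of_bound (hgm.comp_aemeasurable (hz 0).aemeasurable).aestronglyMeasurable
      (2 * (C * ‖m‖)) (ae_of_all _ fun ω => ?_)
    simp only [hg, Function.comp_apply, norm_mul, Real.norm_ofNat]
    gcongr
    exact (norm_inner_le_norm _ _).trans (by gcongr; exact hC _)
  have clt := tendstoInDistribution_inv_sqrt_mul_sum_sub (P := μ) (X := fun i => g ∘ z i)
    (P' := gaussianReal 0 (4 * Var[fun u => ⟪ψ u, m⟫; ν]).toNNReal) (Y := id)
    (by rw [hvar]; exact HasLaw.id) hmem (hind.comp (fun _ => g) fun _ => hgm) hid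
  rw [hgint] at clt
  refine tendstoInDistribution_of_tendstoInMeasure_sub _ _ clt ?_
    fun n => ((aemeasurable_innerUStat fun i => hψz i).sub_const _).const_mul _
  -- the degenerate part
  have horth : ∀ i j : ℕ, i ≠ j → ∫ ω, ⟪ψ (z i ω) - m, ψ (z j ω) - m⟫ ∂μ = 0 := by
    intro i j hij
    have hi : Integrable (fun u => ψ u - m) ν := hψi.sub (integrable_const _)
    have := (hind.indepFun hij).integral_bilin_comp_comp (f := fun u => ψ u - m)
      (g := fun u => ψ u - m) (hz i).aemeasurable (hz j).aemeasurable
      ((hz i).map_eq ▸ hi) ((hz j).map_eq ▸ hi) (innerSL ℝ)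
    have h0 : ∫ ω, (ψ (z i ω) - m) ∂μ = 0 := by
      have := (hz i).integral_comp hi.1
      rw [Function.comp_def] at this
      rw [this, integral_sub hψi (integrable_const _)]
      simp [hm]
    rw [h0, map_zero] at this
    exact this
  have hbound : ∀ u, ‖ψ u - m‖ ≤ C + ‖m‖ := fun u => (norm_sub_le _ _).trans (by
    gcongr; exact hC u)
  refine tendstoInMeasure_zero_of_tendsto_lintegral_enorm (fun n => ?_) ?_
  · exact ((((aemeasurable_innerUStat fun i => hψz i).sub_const _).const_mul _).sub
      (clt.forall_aemeasurable n)).aestronglyMeasurable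
  have hlim : Tendsto (fun n : ℕ => ENNReal.ofReal (4 * (C + ‖m‖) ^ 2 * (√(n : ℝ))⁻¹)) atTop
      (𝓝 0) := by
    rw [← ENNReal.ofReal_zero, ← mul_zero (4 * (C + ‖m‖) ^ 2)]
    exact ENNReal.tendsto_ofReal (tendsto_const_nhds.mul (tendsto_inv_atTop_zero.comp
      (Real.tendsto_sqrt_atTop.comp tendsto_natCast_atTop_atTop)))
  refine tendsto_of_tendsto_of_tendsto_of_le_of_le' tendsto_const_nhds hlim
    (Eventually.of_forall fun _ => zero_le) ?_
  filter_upwards [eventually_ge_atTop 2] with n hn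
  have hn' : (2 : ℝ) ≤ n := by exact_mod_cast hn
  have hs : √(n : ℝ) * √(n : ℝ) = n := Real.mul_self_sqrt (by positivity)
  have hs0 : 0 < √(n : ℝ) := Real.sqrt_pos.2 (by positivity)
  have key : ∀ ω, √(n : ℝ) * (innerUStat (fun i : Fin n => ψ (z i ω)) - ‖m‖ ^ 2)
      - (√(n : ℝ))⁻¹ * (∑ i ∈ Finset.range n, (g ∘ z i) ω - n * (2 * ‖m‖ ^ 2))
      = (√(n : ℝ) * (1 / ((n : ℝ) * ((n : ℝ) - 1)))) *
        (‖∑ i : Fin n, (ψ (z i ω) - m)‖ ^ 2 - ∑ i : Fin n, ‖ψ (z i ω) - m‖ ^ 2) := by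
    intro ω
    have h2 : √(n : ℝ) * (2 / n) = 2 * (√(n : ℝ))⁻¹ := by
      rw [mul_div_left_comm, Real.sqrt_div_self', one_div]
    rw [innerUStat_decomposition hn _ m, Finset.sum_range]
    simp only [hg, Function.comp_apply, ← Finset.mul_sum]
    rw [mul_add, ← mul_assoc, h2]
    ring
  calc ∫⁻ ω, ‖√(n : ℝ) * (innerUStat (fun i : Fin n => ψ (z i ω)) - ‖m‖ ^ 2)
      - (√(n : ℝ))⁻¹ * (∑ i ∈ Finset.range n, (g ∘ z i) ω - n * (2 * ‖m‖ ^ 2))‖ₑ ∂μ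
      = ENNReal.ofReal (√(n : ℝ) * (1 / ((n : ℝ) * ((n : ℝ) - 1)))) *
        ∫⁻ ω, ‖‖∑ i : Fin n, (ψ (z i ω) - m)‖ ^ 2 - ∑ i : Fin n, ‖ψ (z i ω) - m‖ ^ 2‖ₑ ∂μ := by
        rw [← lintegral_const_mul' _ _ ENNReal.ofReal_ne_top]
        refine lintegral_congr fun ω => ?_
        rw [key ω, enorm_mul, Real.enorm_of_nonneg]
        have : (0 : ℝ) ≤ (n : ℝ) - 1 := by linarith
        positivity
    _ ≤ ENNReal.ofReal (√(n : ℝ) * (1 / ((n : ℝ) * ((n : ℝ) - 1)))) *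
        ENNReal.ofReal (2 * n * (C + ‖m‖) ^ 2) := by
        gcongr
        exact lintegral_norm_sum_sq_sub_le (v := fun (i : Fin n) ω => ψ (z i ω) - m)
          (fun i => (hψz i).sub aestronglyMeasurable_const) (fun i ω => hbound _)
          fun i j hij => horth i j fun h => hij (Fin.ext h)
    _ ≤ ENNReal.ofReal (4 * (C + ‖m‖) ^ 2 * (√(n : ℝ))⁻¹) := by
        have h1 : (0 : ℝ) < (n : ℝ) - 1 := by linarith
        rw [← ENNReal.ofReal_mul (by positivity)]
        refine ENNReal.ofReal_le_ofReal ?_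
        have e : √(n : ℝ) * (1 / ((n : ℝ) * ((n : ℝ) - 1))) * (2 * n * (C + ‖m‖) ^ 2)
            = 2 * (C + ‖m‖) ^ 2 * (√(n : ℝ) / ((n : ℝ) - 1)) := by
          field_simp
        have e' : 4 * (C + ‖m‖) ^ 2 * (√(n : ℝ))⁻¹ = 2 * (C + ‖m‖) ^ 2 * (2 / √(n : ℝ)) := by
          ring
        rw [e, e']
        refine mul_le_mul_of_nonneg_left ?_ (by positivity)
        -- `√n / (n - 1) ≤ 2 / √n` because `n ≤ 2 (n - 1)`
        rw [div_le_div_iff₀ h1 hs0, hs]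
        linarith

end

/-! ### The feature map and the mean embedding -/

noncomputable section
open scoped RealInnerProductSpace

namespace PDKernel

section Feature

variable {X : Type*} (k : PDKernel X)

/-- The canonical feature map `x ↦ k(·, x)` into the reproducing kernel Hilbert space. -/
def feature (x : X) : k.rkhs := RKHS.kerFun k.rkhs x (1 : ℝ)

theorem inner_feature_left (x : X) (f : k.rkhs) : ⟪k.feature x, f⟫ = f x := by
  simp [feature]

theorem inner_feature_feature (x y : X) : ⟪k.feature x, k.feature y⟫ = k x y := by
  rw [inner_feature_left, feature, RKHS.kerFun_apply, RKHS.OfKernel.kernel_ofKernel]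
  simp [opMatrix]

/-- The difference of features of a pair; `h` is its inner product kernel. -/
def featureDiff (z : X × X) : k.rkhs := k.feature z.1 - k.feature z.2

theorem inner_featureDiff (z z' : X × X) : ⟪k.featureDiff z, k.featureDiff z'⟫ = k.h z z' := by
  simp only [featureDiff, inner_sub_left, inner_sub_right, inner_feature_feature, h,
    k.symm z.2 z'.1]
  ring

theorem mmdSqU_eq_innerUStat {n : ℕ} (x y : Fin n → X) :
    k.mmdSqU x y = innerUStat fun i => k.featureDiff (x i, y i) := by
  simp only [mmdSqU, innerUStat, inner_featureDiff]

/-- The maximum mean discrepancy is the distance between the mean embeddings. -/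
theorem mmd_eq_norm [MeasurableSpace X] {P Q : Measure X} (hP : Integrable k.feature P)
    (hQ : Integrable k.feature Q) :
    k.mmd P Q = ‖∫ x, k.feature x ∂P - ∫ x, k.feature x ∂Q‖ := by
  set m := ∫ x, k.feature x ∂P - ∫ x, k.feature x ∂Q with hm
  have hf : ∀ f : k.rkhs, ∫ x, f x ∂P - ∫ x, f x ∂Q = ⟪f, m⟫ := fun f => by
    rw [hm, inner_sub_right, ← integral_inner hP, ← integral_inner hQ]
    simp only [real_inner_comm _ f, inner_feature_left]
  refine IsGreatest.csSup_eq ⟨⟨‖m‖⁻¹ • m, ?_, ?_⟩, ?_⟩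
  · rw [norm_smul, norm_inv, norm_norm]
    exact inv_mul_le_one
  · rw [hf, real_inner_smul_left, real_inner_self_eq_norm_sq]
    rcases eq_or_ne ‖m‖ 0 with h0 | h0
    · simp [h0]
    · rw [sq, inv_mul_cancel_left₀ h0, abs_norm]
  · rintro r ⟨f, hf1, rfl⟩
    rw [hf]
    exact (abs_real_inner_le_norm f m).trans
      (mul_le_of_le_one_left (norm_nonneg _) hf1)

end Feature

section Lipschitz

variable {X : Type*} [NormedAddCommGroup X] (k : PDKernel X) {L : ℝ}

/-- The Lipschitz condition forces the kernel to be constant on the diagonal. -/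
theorem apply_self_eq (hk : ∀ x y u v : X, |k x y - k u v| ≤ L * ‖x - y - (u - v)‖) (x : X) :
    k x x = k 0 0 := by
  simpa [sub_eq_zero] using hk x x 0 0

theorem norm_feature (hk : ∀ x y u v : X, |k x y - k u v| ≤ L * ‖x - y - (u - v)‖) (x : X) :
    ‖k.feature x‖ = √(k 0 0) := by
  rw [norm_eq_sqrt_real_inner, inner_feature_feature, k.apply_self_eq hk]

theorem norm_featureDiff_le (hk : ∀ x y u v : X, |k x y - k u v| ≤ L * ‖x - y - (u - v)‖)
    (z : X × X) : ‖k.featureDiff z‖ ≤ 2 * √(k 0 0) := by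
  refine (norm_sub_le _ _).trans_eq ?_
  rw [k.norm_feature hk, k.norm_feature hk]
  ring

theorem norm_feature_sub_sq_le (hk : ∀ x y u v : X, |k x y - k u v| ≤ L * ‖x - y - (u - v)‖)
    (x y : X) : ‖k.feature x - k.feature y‖ ^ 2 ≤ 2 * L * ‖x - y‖ := by
  rw [norm_sub_sq_real, ← real_inner_self_eq_norm_sq, ← real_inner_self_eq_norm_sq,
    inner_feature_feature, inner_feature_feature, inner_feature_feature, k.apply_self_eq hk y,
    ← k.apply_self_eq hk x]
  have := (le_abs_self _).trans (hk x x x y)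
  rw [sub_self, zero_sub, norm_neg] at this
  linarith

theorem continuous_feature (hk : ∀ x y u v : X, |k x y - k u v| ≤ L * ‖x - y - (u - v)‖) :
    Continuous k.feature := by
  refine continuous_iff_continuousAt.2 fun y => ?_
  rw [ContinuousAt, tendsto_iff_norm_sub_tendsto_zero]
  have h1 : Tendsto (fun x => √(2 * L * ‖x - y‖)) (𝓝 y) (𝓝 0) := by
    have : Continuous fun x => √(2 * L * ‖x - y‖) := by fun_prop
    simpa using this.tendsto y
  exact squeeze_zero (fun _ => norm_nonneg _)
    (fun x => Real.le_sqrt_of_sq_le (k.norm_feature_sub_sq_le hk x y)) h1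

theorem continuous_featureDiff (hk : ∀ x y u v : X, |k x y - k u v| ≤ L * ‖x - y - (u - v)‖) :
    Continuous k.featureDiff :=
  ((k.continuous_feature hk).comp continuous_fst).sub ((k.continuous_feature hk).comp continuous_snd)

variable [SecondCountableTopology X] [MeasurableSpace X] [BorelSpace X]

theorem integrable_feature (hk : ∀ x y u v : X, |k x y - k u v| ≤ L * ‖x - y - (u - v)‖)
    (P : Measure X) [IsFiniteMeasure P] : Integrable k.feature P :=
  Integrable.of_bound (k.continuous_feature hk).aestronglyMeasurable _
    (ae_of_all _ fun x => (k.norm_feature hk x).le)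

theorem integrable_featureDiff (hk : ∀ x y u v : X, |k x y - k u v| ≤ L * ‖x - y - (u - v)‖)
    (P : Measure (X × X)) [IsFiniteMeasure P] : Integrable k.featureDiff P :=
  Integrable.of_bound (k.continuous_featureDiff hk).aestronglyMeasurable _
    (ae_of_all _ (k.norm_featureDiff_le hk))

theorem mmd_eq_norm_integral_featureDiff
    (hk : ∀ x y u v : X, |k x y - k u v| ≤ L * ‖x - y - (u - v)‖)
    (P Q : Measure X) [IsProbabilityMeasure P] [IsProbabilityMeasure Q] :
    k.mmd P Q = ‖∫ z, k.featureDiff z ∂(P.prod Q)‖ := by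
  have hP := k.integrable_feature hk P
  have hQ := k.integrable_feature hk Q
  rw [k.mmd_eq_norm hP hQ]
  simp only [featureDiff]
  rw [integral_sub (hP.comp_fst Q) (hQ.comp_snd P), integral_fun_fst, integral_fun_snd]
  simp

theorem integral_h_eq_inner (hk : ∀ x y u v : X, |k x y - k u v| ≤ L * ‖x - y - (u - v)‖)
    (P : Measure (X × X)) [IsFiniteMeasure P] (z : X × X) :
    ∫ z', k.h z z' ∂P = ⟪k.featureDiff z, ∫ z', k.featureDiff z' ∂P⟫ := by
  simp only [← inner_featureDiff]
  exact integral_inner (k.integrable_featureDiff hk P) _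

end Lipschitz

/-! ### The discretisation error -/

section Perturbation

variable {X : Type*} [NormedAddCommGroup X] (k : PDKernel X) {L : ℝ}

theorem abs_h_sub_le (hL : 0 ≤ L)
    (hk : ∀ x y u v : X, |k x y - k u v| ≤ L * ‖x - y - (u - v)‖) (z z' w w' : X × X) :
    |k.h z z' - k.h w w'| ≤ 2 * L * ((‖z.1 - w.1‖ + ‖z.2 - w.2‖) + (‖z'.1 - w'.1‖ + ‖z'.2 - w'.2‖))
    := by
  have key : ∀ x y u v : X, |k x y - k u v| ≤ L * (‖x - u‖ + ‖y - v‖) := fun x y u v => by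
    refine (hk x y u v).trans (mul_le_mul_of_nonneg_left ?_ hL)
    rw [sub_sub_sub_comm]
    exact norm_sub_le _ _
  have h1 := abs_le.1 (key z.1 z'.1 w.1 w'.1)
  have h2 := abs_le.1 (key z.2 z'.2 w.2 w'.2)
  have h3 := abs_le.1 (key z.1 z'.2 w.1 w'.2)
  have h4 := abs_le.1 (key z'.1 z.2 w'.1 w.2)
  rw [abs_le]
  simp only [h]
  constructor <;> linarith

/-- Moving the sample points changes the U-statistic by at most a multiple of the mean
displacement. -/
theorem abs_mmdSqU_sub_le (hL : 0 ≤ L)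
    (hk : ∀ x y u v : X, |k x y - k u v| ≤ L * ‖x - y - (u - v)‖) {n : ℕ} (x y u v : Fin n → X) :
    |k.mmdSqU x y - k.mmdSqU u v| ≤ 4 * L / n * ∑ i, (‖x i - u i‖ + ‖y i - v i‖) := by
  set e : Fin n → ℝ := fun i => ‖x i - u i‖ + ‖y i - v i‖ with he
  have he0 : ∀ i, 0 ≤ e i := fun i => by positivity
  rcases Nat.lt_or_ge n 2 with hn | hn
  · -- both U-statistics vanish for samples of size at most one
    have h0 : (1 / ((n : ℝ) * ((n : ℝ) - 1))) = 0 := by interval_cases n <;> simp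
    rw [mmdSqU, mmdSqU, h0, zero_mul, zero_mul, sub_zero, abs_zero]
    have := Finset.sum_nonneg fun i (_ : i ∈ Finset.univ) => he0 i
    positivity
  have hn' : (2 : ℝ) ≤ n := by exact_mod_cast hn
  have h1 : (0 : ℝ) < (n : ℝ) - 1 := by linarith
  have hsum : ∑ i, ∑ j with i ≠ j, (e i + e j) = 2 * ((n : ℝ) - 1) * ∑ i, e i := by
    have : ∀ i, ∑ j with i ≠ j, (e i + e j) = ((n : ℝ) - 2) * e i + ∑ j, e j := fun i => by
      rw [Finset.filter_ne, Finset.sum_erase_eq_sub (Finset.mem_univ i), Finset.sum_add_distrib]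
      simp
      ring
    rw [Finset.sum_congr rfl fun i _ => this i, Finset.sum_add_distrib, ← Finset.mul_sum]
    simp
    ring
  rw [mmdSqU, mmdSqU, ← mul_sub, abs_mul, abs_of_nonneg (by positivity)]
  calc _ ≤ (1 / ((n : ℝ) * ((n : ℝ) - 1))) * ∑ i, ∑ j with i ≠ j, 2 * L * (e i + e j) := by
        refine mul_le_mul_of_nonneg_left ?_ (by positivity)
        rw [← Finset.sum_sub_distrib]
        refine (Finset.abs_sum_le_sum_abs _ _).trans (Finset.sum_le_sum fun i _ => ?_)
        rw [← Finset.sum_sub_distrib]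
        exact (Finset.abs_sum_le_sum_abs _ _).trans (Finset.sum_le_sum fun j _ =>
          k.abs_h_sub_le hL hk _ _ _ _)
    _ = 4 * L / n * ∑ i, e i := by
        simp only [← Finset.mul_sum, hsum]
        field_simp
        ring

/-- If `√n` times the expected displacement of each sample point tends to `0`, displacing the
sample does not affect the U-statistic at the scale `√n`. -/
theorem tendsto_lintegral_mmdSqU_sub [MeasurableSpace X] [BorelSpace X]
    [SecondCountableTopology X] (hL : 0 ≤ L)
    (hk : ∀ x y u v : X, |k x y - k u v| ≤ L * ‖x - y - (u - v)‖)
    {P Q : Measure X} {Ω : Type*} [MeasurableSpace Ω] {μ : Measure Ω} {x y : ℕ → Ω → X}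
    (hx : ∀ i, HasLaw (x i) P μ) (hy : ∀ i, HasLaw (y i) Q μ) {T : ℕ → X → X}
    (hTP : ∀ n, AEMeasurable (T n) P) (hTQ : ∀ n, AEMeasurable (T n) Q)
    (hP : Tendsto (fun n : ℕ => ENNReal.ofReal (√(n : ℝ)) * ∫⁻ u, ‖u - T n u‖ₑ ∂P) atTop (𝓝 0))
    (hQ : Tendsto (fun n : ℕ => ENNReal.ofReal (√(n : ℝ)) * ∫⁻ u, ‖u - T n u‖ₑ ∂Q) atTop (𝓝 0)) :
    Tendsto (fun n : ℕ => ∫⁻ ω, ‖√(n : ℝ) *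
        (k.mmdSqU (fun i : Fin n => T n (x i ω)) (fun i : Fin n => T n (y i ω))
          - k.mmdSqU (fun i : Fin n => x i ω) (fun i : Fin n => y i ω))‖ₑ ∂μ) atTop (𝓝 0) := by
  have hlim := ENNReal.Tendsto.const_mul (a := ENNReal.ofReal (4 * L)) (hP.add hQ)
    (.inr ENNReal.ofReal_ne_top)
  rw [add_zero, mul_zero] at hlim
  refine tendsto_of_tendsto_of_tendsto_of_le_of_le' tendsto_const_nhds hlim
    (Eventually.of_forall fun _ => zero_le) ?_
  filter_upwards [eventually_gt_atTop 0] with n hn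
  have hmP : AEMeasurable (fun u => ‖u - T n u‖ₑ) P := (aemeasurable_id.sub (hTP n)).enorm
  have hmQ : AEMeasurable (fun u => ‖u - T n u‖ₑ) Q := (aemeasurable_id.sub (hTQ n)).enorm
  have hmx : ∀ i, AEMeasurable (fun ω => ‖x i ω - T n (x i ω)‖ₑ) μ := fun i =>
    ((hx i).map_eq ▸ hmP).comp_aemeasurable (hx i).aemeasurable
  have hmy : ∀ i, AEMeasurable (fun ω => ‖y i ω - T n (y i ω)‖ₑ) μ := fun i =>
    ((hy i).map_eq ▸ hmQ).comp_aemeasurable (hy i).aemeasurable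
  have hadd : ∀ i : Fin n, AEMeasurable
      (fun ω => ‖x i ω - T n (x i ω)‖ₑ + ‖y i ω - T n (y i ω)‖ₑ) μ :=
    fun i => (hmx i).add (hmy i)
  have hn0 : (0 : ℝ) < n := by exact_mod_cast hn
  calc _ ≤ ∫⁻ ω, ENNReal.ofReal (√(n : ℝ) * (4 * L / n)) *
        ∑ i : Fin n, (‖x i ω - T n (x i ω)‖ₑ + ‖y i ω - T n (y i ω)‖ₑ) ∂μ := by
        refine lintegral_mono fun ω => ?_
        have hb := k.abs_mmdSqU_sub_le hL hk (fun i : Fin n => T n (x i ω))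
          (fun i : Fin n => T n (y i ω)) (fun i : Fin n => x i ω) (fun i : Fin n => y i ω)
        have e : ∀ i : Fin n, ‖x i ω - T n (x i ω)‖ₑ + ‖y i ω - T n (y i ω)‖ₑ
            = ENNReal.ofReal (‖T n (x i ω) - x i ω‖ + ‖T n (y i ω) - y i ω‖) := fun i => by
          rw [ENNReal.ofReal_add (norm_nonneg _) (norm_nonneg _), ofReal_norm, ofReal_norm,
            enorm_sub_rev, enorm_sub_rev (y i ω)]
        simp only [e]
        rw [← ENNReal.ofReal_sum_of_nonneg fun i _ => by positivity,
          ← ENNReal.ofReal_mul (by positivity), ← ofReal_norm, norm_mul,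
          Real.norm_of_nonneg (Real.sqrt_nonneg _), mul_assoc]
        exact ENNReal.ofReal_le_ofReal (mul_le_mul_of_nonneg_left hb (Real.sqrt_nonneg _))
    _ = ENNReal.ofReal (√(n : ℝ) * (4 * L / n)) *
        (n * (∫⁻ u, ‖u - T n u‖ₑ ∂P + ∫⁻ u, ‖u - T n u‖ₑ ∂Q)) := by
        rw [lintegral_const_mul' _ _ ENNReal.ofReal_ne_top,
          lintegral_finsetSum' _ fun i _ => hadd i]
        simp only [lintegral_add_left' (hmx _), (hx _).lintegral_comp hmP,
          (hy _).lintegral_comp hmQ, Finset.sum_const, Finset.card_univ, Fintype.card_fin,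
          nsmul_eq_mul]
    _ = ENNReal.ofReal (4 * L) * (ENNReal.ofReal (√(n : ℝ)) * ∫⁻ u, ‖u - T n u‖ₑ ∂P
          + ENNReal.ofReal (√(n : ℝ)) * ∫⁻ u, ‖u - T n u‖ₑ ∂Q) := by
        rw [← mul_assoc, ← ENNReal.ofReal_natCast, ← ENNReal.ofReal_mul (by positivity), ← mul_add,
          ← mul_assoc, ← ENNReal.ofReal_mul (by positivity)]
        congr 2
        field_simp

end Perturbation

end PDKernel

end

/-! ### The discretised U-statistic -/

theorem theorem5p3
    {X : Type*} [NormedAddCommGroup X] [InnerProductSpace ℝ X] [CompleteSpace X]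
    [SecondCountableTopology X] [MeasurableSpace X] [BorelSpace X]
    -- the kernel and its Lipschitz condition
    (k : PDKernel X) (L : ℝ) (hL : 0 < L)
    (hk : ∀ x y u v : X, |k x y - k u v| ≤ L * ‖x - y - (u - v)‖)
    -- the two distributions
    (P Q : Measure X) [IsProbabilityMeasure P] [IsProbabilityMeasure Q] (hPQ : P ≠ Q)
    -- independent i.i.d. samples from `P` and from `Q`
    {Ω : Type*} [MeasurableSpace Ω] (μ : Measure Ω) [IsProbabilityMeasure μ]
    (x y : ℕ → Ω → X)
    (hx : ∀ i, HasLaw (x i) P μ) (hy : ∀ i, HasLaw (y i) Q μ)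
    (hindep : iIndepFun (Sum.elim x y) μ)
    -- discretisation maps `I n`, to dimension `N n`, and reconstruction maps `R n`
    (N : ℕ → ℕ) (hN : Tendsto N atTop atTop)
    (I : ∀ n, X → EuclideanSpace ℝ (Fin (N n)))
    (R : ∀ n, EuclideanSpace ℝ (Fin (N n)) → X)
    (hRIP : ∀ n, AEMeasurable (fun u => R n (I n u)) P)
    (hRIQ : ∀ n, AEMeasurable (fun u => R n (I n u)) Q)
    -- `√n E‖x - R I x‖ → 0` under `P` and under `Q`
    (hP : Tendsto (fun n : ℕ => ENNReal.ofReal (√(n : ℝ)) * ∫⁻ u, ‖u - R n (I n u)‖ₑ ∂P)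
      atTop (𝓝 0))
    (hQ : Tendsto (fun n : ℕ => ENNReal.ofReal (√(n : ℝ)) * ∫⁻ u, ‖u - R n (I n u)‖ₑ ∂Q)
      atTop (𝓝 0)) :
    TendstoInDistribution
      (fun (n : ℕ) (ω : Ω) =>
        √(n : ℝ) *
          (k.mmdSqU (fun i : Fin n => R n (I n (x i ω))) (fun i : Fin n => R n (I n (y i ω)))
            - k.mmd P Q ^ 2))
      atTop (id : ℝ → ℝ) (fun _ => μ)
      (gaussianReal 0
        (4 * Var[fun z => ∫ z', k.h z z' ∂(P.prod Q); P.prod Q]).toNNReal) := by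
  set T : ℕ → X → X := fun n u => R n (I n u) with hT
  have hind : iIndepFun (fun i ω => (x i ω, y i ω)) μ :=
    hindep.prodMk_of_sumElim (fun i => (hx i).aemeasurable) fun i => (hy i).aemeasurable
  have hz : ∀ i, HasLaw (fun ω => (x i ω, y i ω)) (P.prod Q) μ := fun i =>
    (indepFun_iff_hasLaw_prodMk_prod (hx i) (hy i)).1
      (hindep.indepFun (i := Sum.inl i) (j := Sum.inr i) Sum.inl_ne_inr)
  have clt := tendstoInDistribution_innerUStat hz hind
    (k.continuous_featureDiff hk).stronglyMeasurable (k.norm_featureDiff_le hk)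
  simp only [← k.mmdSqU_eq_innerUStat, ← k.integral_h_eq_inner hk,
    ← k.mmd_eq_norm_integral_featureDiff hk] at clt
  have hmeas : ∀ n : ℕ, AEMeasurable (fun ω => √(n : ℝ) *
      (k.mmdSqU (fun i : Fin n => T n (x i ω)) (fun i : Fin n => T n (y i ω))
        - k.mmd P Q ^ 2)) μ := fun n => by
    simp only [k.mmdSqU_eq_innerUStat]
    refine ((aemeasurable_innerUStat fun i => ?_).sub_const _).const_mul _
    have h1 : AEMeasurable (fun ω => T n (x i ω)) μ :=
      ((hx i).map_eq ▸ hRIP n : AEMeasurable (T n) (μ.map (x i))).comp_aemeasurable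
        (hx i).aemeasurable
    have h2 : AEMeasurable (fun ω => T n (y i ω)) μ :=
      ((hy i).map_eq ▸ hRIQ n : AEMeasurable (T n) (μ.map (y i))).comp_aemeasurable
        (hy i).aemeasurable
    exact (k.continuous_featureDiff hk).comp_aestronglyMeasurable
      (h1.prodMk h2).aestronglyMeasurable
  refine tendstoInDistribution_of_tendstoInMeasure_sub _ _ clt ?_ hmeas
  refine tendstoInMeasure_zero_of_tendsto_lintegral_enorm
    (fun n => ((hmeas n).sub (clt.forall_aemeasurable n)).aestronglyMeasurable) ?_
  simpa only [Pi.sub_apply, ← mul_sub, sub_sub_sub_cancel_right] using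
    k.tendsto_lintegral_mmdSqU_sub hL.le hk hx hy hRIP hRIQ hP hQ
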